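/- Let $(X_t,Y_t)_{t\ge 1}$ be a stochastic process on a probability space, with $X_t\in\mathbb R^p$, $Y_t\in\mathbb R^q$, $p,q\ge1$, that is strictly stationary, centered, (jointly) Gaussian and $\alpha$-mixing. Here $$\alpha(l)=\sup_{t}\ \sup\bigl\{|\mathbb P(A\cap B)-\mathbb P(A)\mathbb P(B)| : A\in\sigma((X_s,Y_s):s\le t),\ B\in\sigma((X_s,Y_s):s\ge t+l)\bigr\},\qquad l\ge 0,$$ $\alpha$-mixing means $\alpha(l)\to0$ as $l\to\infty$, and $S_\alpha(T)=\sum_{l=0}^{T}\alpha(l)$. Let $\Sigma_X=\mathbb E[X_tX_t']$, $\Sigma_Y=\mathbb E[Y_tY_t']$, and let $\Theta^\ast\in\mathbb R^{p\times q}$ be any minimizer of $\Theta\mapsto\mathbb E\|Y_t-\Theta'X_t\|_2^2$. For $T\ge1$ let $\mathbf X=(X_1,\dots,X_T)'\in\mathbb R^{T\times p}$, $\mathbf Y=(Y_1,\dots,Y_T)'\in\mathbb R^{T\times q}$ and $\mathbf W=\mathbf Y-\mathbf X\Theta^\ast$. For a matrix $M$ write $\|M\|$ for its operator norm (with respect to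 Euclidean norms), $\|M\|_\infty=\max_{i,j}|M_{ij}|$, and $M_{:j}$ for its $j$-th column. For $b,\tilde c>0$ let $\mathrm{DB}(b,\tilde c,p,q,T)$ be the assertion that for every such process and every such $\Theta^\ast$, $$\mathbb P\left[\left\|\frac{\mathbf X'\mathbf W}{T}\right\|_\infty\le 8\pi\sqrt{\frac{b+1}{\tilde c}}\Bigl(\|\Sigma_X\|\bigl(1+\max_{1\le j\le q}\|\Theta^\ast_{:j}\|_2^2\bigr)+\|\Sigma_Y\|\Bigr)\,S_\alpha(T)\sqrt{\frac{\log(pq)}{T}}\right]\ \ge\ 1-8\exp(-b\log(pq)).$$ **Proposition (Deviation Bound, Gaussian case).** 1. There is a universal constant $\tilde c>0$ such that for every $b>0$ and all integers $p,q,T\ge1$ with $T\ge\frac{b+1}{\tilde c}\log(pq)$, $\mathrm{DB}(b,\tilde c,p,q,T)$ holds. 2. For every $B>0$ there is a constant $\tilde c>0$, depending only on $B$, such that for every $0<b\le B$ and all integers $p,q,T\ge1$ with $T\ge\sqrt{\frac{b+1}{\tilde c}}\,\log(pq)$, $\mathrm{DB}(b,\tilde c,p,q,T)$ holds. -/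

import Mathlib

open MeasureTheory ProbabilityTheory Filter Topology

universe u

noncomputable section

namespace LassoMixing

/-! ### Mixing coefficients -/

/-- The `α` measure of dependence between two σ-algebras,
`sup {|P(A ∩ B) - P(A) P(B)| : A ∈ 𝓐, B ∈ 𝓑}`. -/
def alphaDep {Ω : Type u} {mΩ : MeasurableSpace Ω} (P : Measure Ω) (𝓐 𝓑 : MeasurableSpace Ω) : ℝ :=
  sSup {r : ℝ | ∃ A B : Set Ω, MeasurableSet[𝓐] A ∧ MeasurableSet[𝓑] B ∧
    r = |P.real (A ∩ B) - P.real A * P.real B|}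

/-- The σ-algebra generated by `Z s`, `s ∈ I`. -/
abbrev sigmaOf {Ω E : Type*} [MeasurableSpace E] (Z : ℕ → Ω → E) (I : Set ℕ) :
    MeasurableSpace Ω :=
  ⨆ s ∈ I, MeasurableSpace.comap (Z s) inferInstance

/-- The mixing coefficient `α(l)` of the process `Z`: the dependence between the past up to
time `t` and the future from time `t + l` on, maximised over the times `t`. -/
def alphaCoeff {Ω : Type u} {E : Type*} [MeasurableSpace Ω] [MeasurableSpace E]
    (P : Measure Ω) (Z : ℕ → Ω → E) (l : ℕ) : ℝ :=
  ⨆ t : ℕ, alphaDep P (sigmaOf Z (Set.Iic t)) (sigmaOf Z (Set.Ici (t + l)))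

/-- `Z` is an `α`-mixing process. -/
def IsAlphaMixing {Ω : Type u} {E : Type*} [MeasurableSpace Ω] [MeasurableSpace E]
    (P : Measure Ω) (Z : ℕ → Ω → E) : Prop :=
  Tendsto (alphaCoeff P Z) atTop (𝓝 0)

/-- `S_α(T) = ∑_{l = 0}^{T} α(l)`. -/
def alphaSum {Ω : Type u} {E : Type*} [MeasurableSpace Ω] [MeasurableSpace E]
    (P : Measure Ω) (Z : ℕ → Ω → E) (T : ℕ) : ℝ :=
  ∑ l ∈ Finset.range (T + 1), alphaCoeff P Z l

/-- Strict stationarity: `(Z_m, …, Z_{m+n})` and `(Z_{m+τ}, …, Z_{m+n+τ})` have the same law. -/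
def IsStrictlyStationary {Ω : Type u} {E : Type*} [MeasurableSpace Ω] [MeasurableSpace E]
    (P : Measure Ω) (Z : ℕ → Ω → E) : Prop :=
  ∀ m τ n : ℕ, P.map (fun ω (i : Fin (n + 1)) => Z (m + i) ω) =
    P.map (fun ω (i : Fin (n + 1)) => Z (m + i + τ) ω)

/-! ### The regression problem -/

/-- The process of pairs `(X_t, Y_t)`. -/
def pairProcess {Ω : Type u} {p q : ℕ} (X : ℕ → Ω → EuclideanSpace ℝ (Fin p))
    (Y : ℕ → Ω → EuclideanSpace ℝ (Fin q)) (t : ℕ) (ω : Ω) :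
    EuclideanSpace ℝ (Fin p) × EuclideanSpace ℝ (Fin q) :=
  (X t ω, Y t ω)

/-- The standing assumptions on the process `(X_t, Y_t)`: it is a strictly stationary, centered,
Gaussian, `α`-mixing process. -/
structure IsGaussianMixingModel {Ω : Type u} [MeasurableSpace Ω] (P : Measure Ω) {p q : ℕ}
    (X : ℕ → Ω → EuclideanSpace ℝ (Fin p)) (Y : ℕ → Ω → EuclideanSpace ℝ (Fin q)) : Prop where
  measurable_X : ∀ t, Measurable (X t)
  measurable_Y : ∀ t, Measurable (Y t)
  stationary : IsStrictlyStationary P (pairProcess X Y)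
  centered_X : ∀ t, ∫ ω, X t ω ∂P = 0
  centered_Y : ∀ t, ∫ ω, Y t ω ∂P = 0
  gaussian : IsGaussianProcess (pairProcess X Y) P
  mixing : IsAlphaMixing P (pairProcess X Y)

/-- The matrix `E[V V']` of a random vector `V`; `Σ_X` and `Σ_Y` are those of `X_t` and `Y_t`. -/
def secondMoment {Ω : Type u} [MeasurableSpace Ω] (P : Measure Ω) {n : ℕ}
    (V : Ω → EuclideanSpace ℝ (Fin n)) : Matrix (Fin n) (Fin n) ℝ :=
  Matrix.of fun i j => ∫ ω, V ω i * V ω j ∂P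

/-- The operator norm of a square matrix with respect to the Euclidean norm. -/
def opNorm {n : ℕ} (M : Matrix (Fin n) (Fin n) ℝ) : ℝ :=
  ‖Matrix.toEuclideanCLM (𝕜 := ℝ) M‖

/-- The entrywise maximum norm `max_{i,j} |M_{ij}|`. -/
def maxNorm {m n : ℕ} (M : Matrix (Fin m) (Fin n) ℝ) : ℝ :=
  ⨆ ij : Fin m × Fin n, |M ij.1 ij.2|

/-- The largest squared Euclidean norm of a column, `max_j ‖M_{:j}‖₂²`. -/
def maxColNormSq {m n : ℕ} (M : Matrix (Fin m) (Fin n) ℝ) : ℝ :=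
  ⨆ j : Fin n, ‖WithLp.toLp 2 (fun i => M i j)‖ ^ 2

/-- `Θ` minimises the expected squared prediction error `E ‖Y_t - Θ' X_t‖₂²` over all real
`p × q` matrices; for a stationary process this does not depend on `t`, and `t` is taken to be
the initial time. -/
def IsBestLinearPredictor {Ω : Type u} [MeasurableSpace Ω] (P : Measure Ω) {p q : ℕ}
    (X : ℕ → Ω → EuclideanSpace ℝ (Fin p)) (Y : ℕ → Ω → EuclideanSpace ℝ (Fin q))
    (Θ : Matrix (Fin p) (Fin q) ℝ) : Prop :=
  ∀ B : Matrix (Fin p) (Fin q) ℝ,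
    ∫ ω, ‖Y 0 ω - Matrix.toEuclideanLin Θ.transpose (X 0 ω)‖ ^ 2 ∂P ≤
      ∫ ω, ‖Y 0 ω - Matrix.toEuclideanLin B.transpose (X 0 ω)‖ ^ 2 ∂P

/-- The `T × n` matrix whose rows are the first `T` observations (times are counted from `0`). -/
def dataMatrix {Ω : Type u} {n : ℕ} (V : ℕ → Ω → EuclideanSpace ℝ (Fin n)) (T : ℕ) (ω : Ω) :
    Matrix (Fin T) (Fin n) ℝ :=
  Matrix.of fun t i => V t ω i

/-- The matrix of true residuals `𝐖 = 𝐘 - 𝐗 Θ`. -/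
def residualMatrix {Ω : Type u} {p q : ℕ} (X : ℕ → Ω → EuclideanSpace ℝ (Fin p))
    (Y : ℕ → Ω → EuclideanSpace ℝ (Fin q)) (Θ : Matrix (Fin p) (Fin q) ℝ) (T : ℕ) (ω : Ω) :
    Matrix (Fin T) (Fin q) ℝ :=
  dataMatrix Y T ω - dataMatrix X T ω * Θ

/-- The multiplier
`8 π √((b+1)/c) (‖Σ_X‖ (1 + max_j ‖Θ_{:j}‖²) + ‖Σ_Y‖)`. -/
def multiplier {Ω : Type u} [MeasurableSpace Ω] (P : Measure Ω) {p q : ℕ}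
    (X : ℕ → Ω → EuclideanSpace ℝ (Fin p)) (Y : ℕ → Ω → EuclideanSpace ℝ (Fin q))
    (Θ : Matrix (Fin p) (Fin q) ℝ) (b c : ℝ) : ℝ :=
  8 * Real.pi * Real.sqrt ((b + 1) / c) *
    (opNorm (secondMoment P (X 0)) * (1 + maxColNormSq Θ) + opNorm (secondMoment P (Y 0)))

/-- The rate `S_α(T) √(log(pq)/T)`. -/
def rate {Ω : Type u} [MeasurableSpace Ω] (P : Measure Ω) {p q : ℕ}
    (X : ℕ → Ω → EuclideanSpace ℝ (Fin p)) (Y : ℕ → Ω → EuclideanSpace ℝ (Fin q)) (T : ℕ) : ℝ :=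
  alphaSum P (pairProcess X Y) T * Real.sqrt (Real.log ((p : ℝ) * q) / T)

/-- For all processes as in `IsGaussianMixingModel`, of dimensions `p` and `q`, and all best
linear predictors `Θ`, the deviation bound with parameters `b` and `c` holds at sample size `T`
with probability at least `1 - 8 exp(-b log(pq))`. -/
def GaussianDeviationBound (b c : ℝ) (p q T : ℕ) : Prop :=
  ∀ (Ω : Type u) [MeasurableSpace Ω] (P : Measure Ω) [IsProbabilityMeasure P]
    (X : ℕ → Ω → EuclideanSpace ℝ (Fin p)) (Y : ℕ → Ω → EuclideanSpace ℝ (Fin q))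
    (Θ : Matrix (Fin p) (Fin q) ℝ),
    IsGaussianMixingModel P X Y → IsBestLinearPredictor P X Y Θ →
    1 - 8 * Real.exp (-b * Real.log ((p : ℝ) * q)) ≤
      P.real {ω | maxNorm ((1 / (T : ℝ)) •
          ((dataMatrix X T ω).transpose * residualMatrix X Y Θ T ω)) ≤
        multiplier P X Y Θ b c * rate P X Y T}

end LassoMixing

end

/-!
Both parts reduce to a single bound, valid when `T ≥ 4 (b + 1) log(pq)` and `c` is below an
absolute constant (`gaussianDeviationBound_of_le`); the two choices of `c` are made so that
either hypothesis on `T` implies this.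

An entry of `X'W` is `∑ t, X_{ti} W_{tj}`. Its mean is zero by the normal equations
(`IsBestLinearPredictor.integral_mul_eq_zero`), and by polarization four times the entry is the
difference of the sums of squares of the real Gaussian processes `A_t = X_{ti} ± W_{tj}`, which are
linear functionals of the observations. It therefore suffices to control the deviation of
`∑ t < T, A_t²` from its mean and to take a union bound over the `pq` entries.

For a centered Gaussian vector whose covariance matrix has absolute row sums at most `κ`, passing to
principal components makes the sum of squares a sum of independent squared Gaussian variables of
variance at most `κ`; the explicit moment generating function and the Chernoff bound then give a
Hanson–Wright type inequality (`sum_sq_deviation_le`).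

Mixing enters only through the row sums. For a positively correlated centered Gaussian pair with
common variance `v`, the event that both coordinates are positive has probability exceeding `1 / 4`
by at least a constant multiple of the correlation (`quadrant_lower_bound`); negative correlations
reduce to this by changing one sign. Hence `|Cov(A_s, A_t)| ≤ C v α(|s - t|)` with an absolute
constant `C`, and the row sums are at most `2 C v S_α(T)`. Finally, `v` is at most
`3 (‖Σ_X‖ (1 + ‖Θ_{:j}‖²) + ‖Σ_Y‖)` (`integral_polarForm_sq_le`).
-/

namespace LassoMixing

/-! ### Quadrant probabilities of a Gaussian pair -/

lemma gaussianReal_real_Ioi_zero : (gaussianReal 0 1).real (Set.Ioi 0) = 1 / 2 := by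
  set γ := gaussianReal 0 1
  have hneg : γ.real (Set.Iio 0) = γ.real (Set.Ioi 0) := by
    have h : γ.map (fun x ↦ -x) = γ := by simp [γ, gaussianReal_map_neg]
    conv_rhs => rw [← h]
    rw [map_measureReal_apply (by fun_prop) measurableSet_Ioi]
    congr 1
    ext x
    simp
  have hna : NullSingletonClass γ := nullSingletonClass_gaussianReal one_ne_zero
  have h1 : γ.real (Set.Iic 0) = γ.real (Set.Iio 0) := measureReal_congr Iio_ae_eq_Iic.symm
  have h2 := probReal_add_probReal_compl (μ := γ) (measurableSet_Ioi (a := (0 : ℝ)))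
  rw [Set.compl_Ioi] at h2
  linarith

lemma add_le_gaussianReal_real_Ioi_neg {ρ : ℝ} (h0 : 0 ≤ ρ) (h1 : ρ ≤ 1) :
    1 / 2 + gaussianPDFReal 0 1 1 * ρ ≤ (gaussianReal 0 1).real (Set.Ioi (-ρ)) := by
  set γ := gaussianReal 0 1
  have hsplit : γ.real (Set.Ioi (-ρ)) = γ.real (Set.Ioc (-ρ) 0) + γ.real (Set.Ioi 0) := by
    rw [← measureReal_union (Set.Ioc_disjoint_Ioi le_rfl) measurableSet_Ioi,
      Set.Ioc_union_Ioi_eq_Ioi (by linarith)]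
  have hIoc : gaussianPDFReal 0 1 1 * ρ ≤ γ.real (Set.Ioc (-ρ) 0) := by
    have h := gaussianReal_apply_eq_integral 0 (one_ne_zero) (Set.Ioc (-ρ) 0)
    rw [measureReal_def, h, ENNReal.toReal_ofReal
      (setIntegral_nonneg measurableSet_Ioc fun x _ ↦ gaussianPDFReal_nonneg 0 1 x)]
    have hc : ∫ _ in Set.Ioc (-ρ) 0, gaussianPDFReal 0 1 1 = gaussianPDFReal 0 1 1 * ρ := by
      rw [setIntegral_const, measureReal_def, Real.volume_Ioc, ENNReal.toReal_ofReal (by linarith)]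
      simp [mul_comm]
    rw [← hc]
    refine setIntegral_mono_on (by simp) (integrable_gaussianPDFReal 0 1).integrableOn
      measurableSet_Ioc fun x hx ↦ ?_
    simp only [gaussianPDFReal]
    gcongr ?_ * Real.exp ?_
    simp only [sub_zero]
    have : x ^ 2 ≤ 1 ^ 2 := by nlinarith [hx.1, hx.2]
    gcongr
  rw [hsplit, gaussianReal_real_Ioi_zero]
  linarith

/-- A constant `c₀` such that the quadrant probability of a standard Gaussian pair with correlation
`ρ ≥ 0` is at least `1 / 4 + c₀ ρ`; its optimal value `1 / (2π)` is not needed. -/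
noncomputable def quadrantSlope : ℝ :=
  (gaussianReal 0 1).real (Set.Ioi 1) * gaussianPDFReal 0 1 1

lemma quadrantSlope_pos : 0 < quadrantSlope := by
  refine mul_pos ?_ (gaussianPDFReal_pos 0 1 1 one_ne_zero)
  refine (measureReal_nonneg).lt_of_ne' fun h ↦ ?_
  rw [measureReal_eq_zero_iff] at h
  have := gaussianReal_absolutelyContinuous' 0 (v := 1) one_ne_zero h
  simp at this

section Gaussian

variable {Ω : Type*} {mΩ : MeasurableSpace Ω} {P : Measure Ω}

lemma map_eq_standardGaussian {U : Ω → ℝ} (hU : HasGaussianLaw U P) (hmean : P[U] = 0)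
    (hvar : Var[U; P] = 1) : P.map U = gaussianReal 0 1 := by
  rw [hU.map_eq_gaussianReal, hmean, hvar, Real.toNNReal_one]

/-- A centered Gaussian variable, possibly of variance zero, as a scaled standard one. -/
lemma map_eq_map_standardGaussian {R : Ω → ℝ} (hR : HasGaussianLaw R P) (hmean : P[R] = 0) :
    P.map R = (gaussianReal 0 1).map (√Var[R; P] * ·) := by
  rw [hR.map_eq_gaussianReal, hmean, gaussianReal_map_const_mul, mul_zero, mul_one]
  congr 1
  ext
  simp [Real.sq_sqrt, variance_nonneg]

lemma real_preimage_eq {R : Ω → ℝ} (hR : HasGaussianLaw R P) (hmean : P[R] = 0) {s : Set ℝ}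
    (hs : MeasurableSet s) :
    P.real (R ⁻¹' s) = (gaussianReal 0 1).real ((√Var[R; P] * ·) ⁻¹' s) := by
  rw [← map_measureReal_apply (f := (√Var[R; P] * ·)) (by fun_prop) hs,
    ← map_eq_map_standardGaussian hR hmean, measureReal_def, measureReal_def,
    Measure.map_apply_of_aemeasurable hR.aemeasurable hs]

/-- Shrinking a standard Gaussian variable towards the origin only increases the probability of a
half-line that contains the origin in its interior. -/
lemma gaussianReal_real_Ioi_le {R : Ω → ℝ} (hR : HasGaussianLaw R P) (hmean : P[R] = 0)
    (hvar : Var[R; P] ≤ 1) {r : ℝ} (hr : 0 < r) :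
    (gaussianReal 0 1).real (Set.Ioi (-r)) ≤ P.real (R ⁻¹' Set.Ioi (-r)) := by
  rw [real_preimage_eq hR hmean measurableSet_Ioi]
  refine measureReal_mono fun x hx ↦ ?_
  simp only [Set.mem_Ioi, Set.mem_preimage] at hx ⊢
  have h0 := Real.sqrt_nonneg Var[R; P]
  have h1 : √Var[R; P] ≤ 1 := Real.sqrt_le_one.mpr hvar
  rcases le_or_gt 0 x with hx0 | hx0
  · nlinarith [mul_nonneg h0 hx0]
  · nlinarith

lemma half_le_real_nonneg {R : Ω → ℝ} (hR : HasGaussianLaw R P) (hmean : P[R] = 0) :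
    1 / 2 ≤ P.real (R ⁻¹' Set.Ici 0) := by
  rw [real_preimage_eq hR hmean measurableSet_Ici, ← gaussianReal_real_Ioi_zero]
  exact measureReal_mono fun x hx ↦ mul_nonneg (Real.sqrt_nonneg _) (le_of_lt hx)

/-- For a standard Gaussian pair with correlation `ρ > 0`, the probability of the positive quadrant
exceeds `1 / 4` by at least a constant multiple of `ρ`. With `R = V - ρ U`, which is independent of
`U`, the quadrant contains `{0 < U ≤ 1, 0 ≤ R}` and `{1 < U, -ρ < R}`. -/
lemma quadrant_lower_bound {U V : Ω → ℝ} (hUV : HasGaussianLaw (fun ω ↦ (U ω, V ω)) P)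
    (hU0 : P[U] = 0) (hV0 : P[V] = 0) (hU1 : Var[U; P] = 1) (hV1 : Var[V; P] = 1)
    (hρ : 0 < cov[U, V; P]) :
    1 / 4 + quadrantSlope * cov[U, V; P] ≤ P.real {ω | 0 < U ω ∧ 0 < V ω} := by
  have := hUV.isProbabilityMeasure
  set ρ := cov[U, V; P] with hρdef
  have hUm := hUV.fst.memLp_two
  have hVm := hUV.snd.memLp_two
  set R : Ω → ℝ := fun ω ↦ V ω - ρ * U ω with hR
  have hUR : HasGaussianLaw (fun ω ↦ (U ω, R ω)) P :=
    hUV.map_fun ((ContinuousLinearMap.fst ℝ ℝ ℝ).prod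
      (ContinuousLinearMap.snd ℝ ℝ ℝ - ρ • ContinuousLinearMap.fst ℝ ℝ ℝ))
  have hcov : cov[U, R; P] = 0 := by
    rw [hR, covariance_fun_sub_right hUm hVm (hUm.const_mul ρ), covariance_const_mul_right,
      covariance_self hUV.fst.aemeasurable, hU1, mul_one, sub_self]
  have hind := hUR.indepFun_of_covariance_eq_zero hcov
  have hRmean : P[R] = 0 := by
    rw [hR, integral_sub hUV.snd.integrable (hUV.fst.integrable.const_mul ρ), integral_const_mul,
      hU0, hV0, mul_zero, sub_zero]
  have hRvar : Var[R; P] = 1 - ρ ^ 2 := by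
    rw [hR, variance_fun_sub hVm (hUm.const_mul ρ), variance_const_mul, hU1, hV1,
      covariance_const_mul_right, covariance_comm, ← hρdef]
    ring
  have hρ1 : ρ ≤ 1 := by nlinarith [variance_nonneg R P]
  have hRle : Var[R; P] ≤ 1 := by rw [hRvar]; nlinarith
  have hlaw := map_eq_standardGaussian hUV.fst hU0 hU1
  have hmap : ∀ s : Set ℝ, MeasurableSet s → P.real (U ⁻¹' s) = (gaussianReal 0 1).real s := by
    intro s hs
    rw [measureReal_def, measureReal_def, ← hlaw,
      Measure.map_apply_of_aemeasurable hUV.fst.aemeasurable hs]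
  have hprod : ∀ s t : Set ℝ, MeasurableSet s → MeasurableSet t →
      P.real (U ⁻¹' s ∩ R ⁻¹' t) = (gaussianReal 0 1).real s * P.real (R ⁻¹' t) := by
    intro s t hs ht
    rw [← hmap s hs, measureReal_def, hind.measure_inter_preimage_eq_mul s t hs ht,
      ENNReal.toReal_mul]
    rfl
  set a := (gaussianReal 0 1).real (Set.Ioi 1) with ha
  have ha0 : 0 ≤ a := measureReal_nonneg
  have hsum : (gaussianReal 0 1).real (Set.Ioc 0 1) + a = 1 / 2 := by
    rw [← gaussianReal_real_Ioi_zero, ha,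
      ← measureReal_union (Set.Ioc_disjoint_Ioi le_rfl) measurableSet_Ioi,
      Set.Ioc_union_Ioi_eq_Ioi zero_le_one]
  have hIoc0 : 0 ≤ (gaussianReal 0 1).real (Set.Ioc 0 1) := measureReal_nonneg
  have hdisj : AEDisjoint P (U ⁻¹' Set.Ioc 0 1 ∩ R ⁻¹' Set.Ici 0)
      (U ⁻¹' Set.Ioi 1 ∩ R ⁻¹' Set.Ioi (-ρ)) := by
    refine Disjoint.aedisjoint (Set.disjoint_left.mpr ?_)
    rintro ω ⟨h1, -⟩ ⟨h2, -⟩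
    exact absurd h1.2 (not_le.mpr h2)
  have hnull : NullMeasurableSet (U ⁻¹' Set.Ioi 1 ∩ R ⁻¹' Set.Ioi (-ρ)) P :=
    (hUR.fst.aemeasurable.nullMeasurable measurableSet_Ioi).inter
      (hUR.snd.aemeasurable.nullMeasurable measurableSet_Ioi)
  have hsub : (U ⁻¹' Set.Ioc 0 1 ∩ R ⁻¹' Set.Ici 0) ∪ (U ⁻¹' Set.Ioi 1 ∩ R ⁻¹' Set.Ioi (-ρ)) ⊆
      {ω | 0 < U ω ∧ 0 < V ω} := by
    rintro ω (⟨h1, h2⟩ | ⟨h1, h2⟩)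
    · simp only [Set.mem_preimage, Set.mem_Ioc, Set.mem_Ici, hR] at h1 h2
      have := mul_pos hρ h1.1
      exact ⟨h1.1, by linarith⟩
    · simp only [Set.mem_preimage, Set.mem_Ioi, hR] at h1 h2
      exact ⟨by linarith, by nlinarith⟩
  have hA := half_le_real_nonneg hUR.snd hRmean
  have hB := (add_le_gaussianReal_real_Ioi_neg hρ.le hρ1).trans
    (gaussianReal_real_Ioi_le hUR.snd hRmean hRle hρ)
  calc 1 / 4 + quadrantSlope * ρ
      = (gaussianReal 0 1).real (Set.Ioc 0 1) * (1 / 2)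
          + a * (1 / 2 + gaussianPDFReal 0 1 1 * ρ) := by
        rw [quadrantSlope, ← ha, eq_sub_of_add_eq hsum]; ring
    _ ≤ (gaussianReal 0 1).real (Set.Ioc 0 1) * P.real (R ⁻¹' Set.Ici 0)
          + a * P.real (R ⁻¹' Set.Ioi (-ρ)) := by
        gcongr
    _ = P.real ((U ⁻¹' Set.Ioc 0 1 ∩ R ⁻¹' Set.Ici 0) ∪
          (U ⁻¹' Set.Ioi 1 ∩ R ⁻¹' Set.Ioi (-ρ))) := by
        rw [measureReal_union₀ hnull hdisj, hprod _ _ measurableSet_Ioc measurableSet_Ici,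
          hprod _ _ measurableSet_Ioi measurableSet_Ioi]
    _ ≤ P.real {ω | 0 < U ω ∧ 0 < V ω} := measureReal_mono hsub

/-! ### Covariances and the mixing coefficients -/

lemma abs_inter_sub_mul_le_one [IsProbabilityMeasure P] (A B : Set Ω) :
    |P.real (A ∩ B) - P.real A * P.real B| ≤ 1 := by
  have h1 : P.real (A ∩ B) ≤ 1 := measureReal_le_one
  have h2 : P.real A * P.real B ≤ 1 :=
    mul_le_one₀ measureReal_le_one measureReal_nonneg measureReal_le_one
  have h3 : 0 ≤ P.real (A ∩ B) := measureReal_nonneg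
  have h4 : 0 ≤ P.real A * P.real B := mul_nonneg measureReal_nonneg measureReal_nonneg
  rw [abs_le]
  constructor <;> linarith

lemma abs_sub_le_alphaDep [IsProbabilityMeasure P] {𝓐 𝓑 : MeasurableSpace Ω} {A B : Set Ω}
    (hA : MeasurableSet[𝓐] A) (hB : MeasurableSet[𝓑] B) :
    |P.real (A ∩ B) - P.real A * P.real B| ≤ alphaDep P 𝓐 𝓑 :=
  le_csSup ⟨1, by rintro _ ⟨A, B, -, -, rfl⟩; exact abs_inter_sub_mul_le_one A B⟩
    ⟨A, B, hA, hB, rfl⟩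

lemma alphaDep_nonneg (𝓐 𝓑 : MeasurableSpace Ω) : 0 ≤ alphaDep P 𝓐 𝓑 := by
  refine Real.sSup_nonneg ?_
  rintro r ⟨A, B, -, -, rfl⟩
  exact abs_nonneg _

lemma alphaDep_le_one [IsProbabilityMeasure P] (𝓐 𝓑 : MeasurableSpace Ω) :
    alphaDep P 𝓐 𝓑 ≤ 1 := by
  refine Real.sSup_le ?_ zero_le_one
  rintro r ⟨A, B, -, -, rfl⟩
  exact abs_inter_sub_mul_le_one A B

lemma quadrantSlope_mul_cov_le_alphaDep {𝓐 𝓑 : MeasurableSpace Ω} {U V : Ω → ℝ}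
    (hUV : HasGaussianLaw (fun ω ↦ (U ω, V ω)) P) (hUA : Measurable[𝓐] U) (hVB : Measurable[𝓑] V)
    (hU0 : P[U] = 0) (hV0 : P[V] = 0) (hU1 : Var[U; P] = 1) (hV1 : Var[V; P] = 1) :
    quadrantSlope * cov[U, V; P] ≤ alphaDep P 𝓐 𝓑 := by
  have := hUV.isProbabilityMeasure
  rcases le_or_gt (cov[U, V; P]) 0 with h | h
  · exact (mul_nonpos_of_nonneg_of_nonpos quadrantSlope_pos.le h).trans (alphaDep_nonneg _ _)
  have hq := quadrant_lower_bound hUV hU0 hV0 hU1 hV1 h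
  have hhalf : ∀ {W : Ω → ℝ}, HasGaussianLaw W P → P[W] = 0 → Var[W; P] = 1 →
      P.real (W ⁻¹' Set.Ioi 0) = 1 / 2 := by
    intro W hW h0 h1
    rw [← gaussianReal_real_Ioi_zero, ← map_eq_standardGaussian hW h0 h1, measureReal_def,
      measureReal_def, Measure.map_apply_of_aemeasurable hW.aemeasurable measurableSet_Ioi]
  have hα := abs_sub_le_alphaDep (P := P) (hUA measurableSet_Ioi) (hVB measurableSet_Ioi)
    (A := U ⁻¹' Set.Ioi 0) (B := V ⁻¹' Set.Ioi 0)
  rw [hhalf hUV.fst hU0 hU1, hhalf hUV.snd hV0 hV1] at hα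
  have hset : U ⁻¹' Set.Ioi 0 ∩ V ⁻¹' Set.Ioi 0 = {ω | 0 < U ω ∧ 0 < V ω} := rfl
  rw [hset] at hα
  have := le_abs_self (P.real {ω | 0 < U ω ∧ 0 < V ω} - 1 / 2 * (1 / 2))
  linarith

/-- For centered jointly Gaussian variables of equal variance, the correlation is controlled by the
`α` measure of dependence: quadrant events already detect it. -/
lemma quadrantSlope_mul_abs_cov_le {𝓐 𝓑 : MeasurableSpace Ω} {U V : Ω → ℝ} {v : ℝ}
    (hUV : HasGaussianLaw (fun ω ↦ (U ω, V ω)) P) (hUA : Measurable[𝓐] U) (hVB : Measurable[𝓑] V)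
    (hU0 : P[U] = 0) (hV0 : P[V] = 0) (hUv : Var[U; P] = v) (hVv : Var[V; P] = v) :
    quadrantSlope * |cov[U, V; P]| ≤ v * alphaDep P 𝓐 𝓑 := by
  have := hUV.isProbabilityMeasure
  have hv : 0 ≤ v := hUv ▸ variance_nonneg U P
  rcases hv.eq_or_lt with rfl | hv
  · have hU : U =ᵐ[P] 0 := by
      have h := (integral_eq_zero_iff_of_nonneg (fun ω ↦ sq_nonneg (U ω))
        hUV.fst.memLp_two.integrable_sq).mp
        ((variance_of_integral_eq_zero hUV.fst.aemeasurable hU0).symm.trans hUv)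
      filter_upwards [h] with ω hω
      simpa using hω
    have h : cov[U, V; P] = 0 := by
      rw [covariance, hU0]
      refine integral_eq_zero_of_ae ?_
      filter_upwards [hU] with ω hω
      simp [hω]
    simp [h]
  -- Both signs reduce to the standardized pair, with `V` replaced by `-V` for the negative sign.
  have key : ∀ c : ℝ, c ^ 2 = v⁻¹ → quadrantSlope * (c * (√v)⁻¹ * cov[U, V; P]) ≤
      alphaDep P 𝓐 𝓑 := by
    intro c hc
    have hs : (√v)⁻¹ ^ 2 = v⁻¹ := by rw [inv_pow, Real.sq_sqrt hv.le]
    have h := quadrantSlope_mul_cov_le_alphaDep (𝓐 := 𝓐) (𝓑 := 𝓑)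
      (U := fun ω ↦ (√v)⁻¹ * U ω) (V := fun ω ↦ c * V ω) (P := P)
      (hUV.map_fun (((√v)⁻¹ • ContinuousLinearMap.fst ℝ ℝ ℝ).prod
        (c • ContinuousLinearMap.snd ℝ ℝ ℝ)))
      (hUA.const_mul _) (hVB.const_mul _)
      (by rw [integral_const_mul, hU0, mul_zero]) (by rw [integral_const_mul, hV0, mul_zero])
      (by rw [variance_const_mul, hUv, hs, inv_mul_cancel₀ hv.ne'])
      (by rw [variance_const_mul, hVv, hc, inv_mul_cancel₀ hv.ne'])
    rw [covariance_const_mul_left, covariance_const_mul_right] at h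
    convert h using 2
    ring
  have hs : (√v)⁻¹ ^ 2 = v⁻¹ := by rw [inv_pow, Real.sq_sqrt hv.le]
  have h1 := key (√v)⁻¹ hs
  have h2 := key (-(√v)⁻¹) (by rw [neg_sq, hs])
  rw [← sq, hs] at h1
  rw [neg_mul, ← sq, hs] at h2
  have h3 : quadrantSlope * |cov[U, V; P]| * v⁻¹ ≤ alphaDep P 𝓐 𝓑 := by
    rcases abs_cases (cov[U, V; P]) with ⟨h, -⟩ | ⟨h, -⟩ <;> rw [h] <;> linarith
  calc quadrantSlope * |cov[U, V; P]| = v * (quadrantSlope * |cov[U, V; P]| * v⁻¹) := by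
        field_simp
    _ ≤ v * alphaDep P 𝓐 𝓑 := by gcongr

/-! ### Concentration of the squared norm of a Gaussian vector -/

lemma integral_exp_mul_sq_gaussianReal {x : ℝ} (hx : x < 1 / 2) :
    ∫ z, Real.exp (x * z ^ 2) ∂gaussianReal 0 1 = (√(1 - 2 * x))⁻¹ := by
  rw [integral_gaussianReal_eq_integral_smul one_ne_zero]
  have h : ∀ z : ℝ, gaussianPDFReal 0 1 z • Real.exp (x * z ^ 2) =
      (√(2 * Real.pi))⁻¹ * Real.exp (-(1 / 2 - x) * z ^ 2) := by
    intro z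
    simp only [gaussianPDFReal, NNReal.coe_one, mul_one, sub_zero, smul_eq_mul]
    rw [mul_assoc, ← Real.exp_add]
    ring_nf
  simp_rw [h]
  rw [integral_const_mul, integral_gaussian, ← Real.sqrt_inv, ← Real.sqrt_mul (by positivity),
    ← Real.sqrt_inv]
  congr 1
  have h1 : (1 / 2 - x) ≠ 0 := by linarith
  have h2 : (1 - 2 * x) ≠ 0 := by linarith
  field_simp

lemma inv_sqrt_one_sub_le_exp {x : ℝ} (hx : |x| ≤ 1 / 4) :
    (√(1 - 2 * x))⁻¹ ≤ Real.exp (x + 4 * x ^ 2) := by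
  obtain ⟨hx1, hx2⟩ := abs_le.mp hx
  have hpos : 0 < 1 - 2 * x := by linarith
  rw [inv_le_iff_one_le_mul₀ (Real.sqrt_pos.mpr hpos)]
  have hE : Real.exp (x + 4 * x ^ 2) = √(Real.exp (2 * x + 8 * x ^ 2)) := by
    rw [show 2 * x + 8 * x ^ 2 = (x + 4 * x ^ 2) + (x + 4 * x ^ 2) by ring,
      Real.exp_add (x + 4 * x ^ 2),
      Real.sqrt_mul_self (Real.exp_pos _).le]
  rw [hE, ← Real.sqrt_mul (Real.exp_pos _).le, Real.one_le_sqrt]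
  have h := Real.add_one_le_exp (2 * x + 8 * x ^ 2)
  nlinarith [mul_le_mul_of_nonneg_right h hpos.le,
    mul_nonneg (sq_nonneg x) (by linarith : 0 ≤ 1 - 4 * x)]

lemma mgf_sq_of_gaussian {X : Ω → ℝ} (hX : HasGaussianLaw X P) (h0 : P[X] = 0) {t : ℝ}
    (ht : |t * Var[X; P]| ≤ 1 / 4) :
    mgf (fun ω ↦ X ω ^ 2) P t = (√(1 - 2 * (t * Var[X; P])))⁻¹ := by
  have h1 : mgf (fun ω ↦ X ω ^ 2) P t = ∫ x, Real.exp (t * x ^ 2) ∂P.map X := by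
    rw [integral_map hX.aemeasurable (by fun_prop)]
    rfl
  rw [h1, map_eq_map_standardGaussian hX h0, integral_map (by fun_prop) (by fun_prop),
    ← integral_exp_mul_sq_gaussianReal (by linarith [(abs_le.mp ht).2])]
  simp_rw [mul_pow, Real.sq_sqrt (variance_nonneg X P), mul_assoc]

/-- An eigenvalue of a matrix is at most its largest absolute row sum. -/
lemma eigenvalue_le_of_row_sum_le {ι : Type*} [Fintype ι] {K : Matrix ι ι ℝ} {v : ι → ℝ} {k κ : ℝ}
    (hv : v ≠ 0) (hK : K.mulVec v = k • v) (hrow : ∀ i, ∑ j, |K i j| ≤ κ) : k ≤ κ := by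
  obtain ⟨i₀, hi₀⟩ := Function.ne_iff.mp hv
  have : Nonempty ι := ⟨i₀⟩
  obtain ⟨i, hi⟩ := Finite.exists_max fun j ↦ |v j|
  have hpos : 0 < |v i| := (abs_pos.mpr hi₀).trans_le (hi i₀)
  have h1 : k * v i = ∑ j, K i j * v j := (congrFun hK i).symm
  refine le_of_mul_le_mul_right ?_ hpos
  calc k * |v i| ≤ |k * v i| := by rw [abs_mul]; gcongr; exact le_abs_self k
    _ ≤ ∑ j, |K i j| * |v j| := by
        rw [h1]
        exact (Finset.abs_sum_le_sum_abs _ _).trans_eq (by simp [abs_mul])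
    _ ≤ ∑ j, |K i j| * |v i| := 
        Finset.sum_le_sum fun j _ ↦ mul_le_mul_of_nonneg_left (hi j) (abs_nonneg _)
    _ ≤ κ * |v i| := by rw [← Finset.sum_mul]; gcongr; exact hrow i

/-- Principal components: a centered Gaussian vector is an orthogonal transformation of a vector of
independent centered Gaussian variables, whose variances are at most the largest absolute row sum
of the covariance matrix. -/
lemma exists_independent_components {ι : Type*} [Fintype ι] {A : ι → Ω → ℝ}
    (hA : HasGaussianLaw (fun ω ↦ (A · ω)) P) (h0 : ∀ i, P[A i] = 0) {κ : ℝ}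
    (hrow : ∀ i, ∑ j, |cov[A i, A j; P]| ≤ κ) :
    ∃ B : ι → Ω → ℝ, iIndepFun B P ∧ (∀ i, HasGaussianLaw (B i) P) ∧ (∀ i, P[B i] = 0) ∧
      (∀ i, Var[B i; P] ≤ κ) ∧ ∀ ω, ∑ i, B i ω ^ 2 = ∑ i, A i ω ^ 2 := by
  classical
  have := hA.isProbabilityMeasure
  have hA2 : ∀ i, MemLp (A i) 2 P := fun i ↦ (hA.eval i).memLp_two
  set K : Matrix ι ι ℝ := Matrix.of fun i j ↦ cov[A i, A j; P] with hKdef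
  have hK : K.IsHermitian := by
    ext i j
    simp [K, covariance_comm]
  set b := hK.eigenvectorBasis
  set B : ι → Ω → ℝ := fun i ω ↦ ∑ s, b i s * A s ω with hB
  have hcov : ∀ i j, cov[B i, B j; P] = hK.eigenvalues j * inner ℝ (b j) (b i) := by
    intro i j
    rw [hB, covariance_fun_sum_fun_sum (fun s ↦ (hA2 s).const_mul _)
      (fun s ↦ (hA2 s).const_mul _)]
    have h : ∀ s, ∑ t, K s t * b j t = hK.eigenvalues j * b j s := fun s ↦
      congrFun (hK.mulVec_eigenvectorBasis j) s
    simp only [covariance_const_mul_left, covariance_const_mul_right]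
    calc ∑ s, ∑ t, b j t * (b i s * cov[A s, A t; P])
        = ∑ s, b i s * ∑ t, K s t * b j t := by
          refine Finset.sum_congr rfl fun s _ ↦ ?_
          rw [Finset.mul_sum]
          exact Finset.sum_congr rfl fun t _ ↦ by simp only [K, Matrix.of_apply]; ring
      _ = _ := by
          simp only [h, PiLp.inner_apply, Finset.mul_sum]
          exact Finset.sum_congr rfl fun s _ ↦ by simp; ring
  have hBg : HasGaussianLaw (fun ω ↦ (B · ω)) P :=
    hA.map_fun (ContinuousLinearMap.pi fun i ↦ ∑ s, b i s • ContinuousLinearMap.proj s) |>.congr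
      (.of_forall fun ω ↦ by ext i; simp [hB])
  refine ⟨B, hBg.iIndepFun_of_covariance_eq_zero fun i j hij ↦ ?_, fun i ↦ hBg.eval i, fun i ↦ ?_,
    fun i ↦ ?_, fun ω ↦ ?_⟩
  · rw [hcov, b.inner_eq_zero hij.symm, mul_zero]
  · rw [hB, integral_finsetSum _ fun s _ ↦ ((hA.eval s).integrable.const_mul _)]
    simp [integral_const_mul, h0]
  · rw [← covariance_self (hBg.eval i).aemeasurable, hcov, b.inner_eq_one, mul_one]
    refine eigenvalue_le_of_row_sum_le (v := b i) (fun h ↦ b.toBasis.ne_zero i ?_)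
      (hK.mulVec_eigenvectorBasis i) hrow
    ext s
    simpa using congrFun h s
  · have h := b.sum_sq_norm_inner_right (WithLp.toLp 2 fun s ↦ A s ω)
    rw [EuclideanSpace.norm_sq_eq] at h
    simpa [hB, PiLp.inner_apply, mul_comm] using h

/-- Moment generating function of the squared norm of a centered Gaussian vector. -/
lemma mgf_sum_sq_le {ι : Type*} [Fintype ι] {B : ι → Ω → ℝ} (hind : iIndepFun B P)
    (hB : ∀ i, HasGaussianLaw (B i) P) (h0 : ∀ i, P[B i] = 0) {κ t : ℝ}
    (hvar : ∀ i, Var[B i; P] ≤ κ) (ht : |t| * κ ≤ 1 / 4) :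
    Integrable (fun ω ↦ Real.exp (t * ∑ i, B i ω ^ 2)) P ∧
    mgf (fun ω ↦ ∑ i, B i ω ^ 2) P t ≤
      Real.exp (t * ∑ i, Var[B i; P] + 4 * t ^ 2 * κ ^ 2 * Fintype.card ι) := by
  have hx : ∀ i, |t * Var[B i; P]| ≤ 1 / 4 := by
    intro i
    rw [abs_mul, abs_of_nonneg (variance_nonneg _ _)]
    exact (mul_le_mul_of_nonneg_left (hvar i) (abs_nonneg t)).trans ht
  have hsq : iIndepFun (fun i ω ↦ B i ω ^ 2) P := hind.comp (fun _ x ↦ x ^ 2) (by fun_prop)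
  have heq : mgf (fun ω ↦ ∑ i, B i ω ^ 2) P t = ∏ i, (√(1 - 2 * (t * Var[B i; P])))⁻¹ := by
    have h := hsq.mgf_sum₀ (t := t) (fun i ↦ (hB i).aemeasurable.pow_const 2) Finset.univ
    have h' : (∑ i, fun ω ↦ B i ω ^ 2) = fun ω ↦ ∑ i, B i ω ^ 2 := by
      ext ω
      simp
    rw [h'] at h
    rw [h]
    exact Finset.prod_congr rfl fun i _ ↦ mgf_sq_of_gaussian (hB i) (h0 i) (hx i)
  have hpos : 0 < mgf (fun ω ↦ ∑ i, B i ω ^ 2) P t := by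
    rw [heq]
    refine Finset.prod_pos fun i _ ↦ inv_pos.mpr (Real.sqrt_pos.mpr ?_)
    linarith [(abs_le.mp (hx i)).2]
  refine ⟨Integrable.of_integral_ne_zero hpos.ne', ?_⟩
  calc mgf (fun ω ↦ ∑ i, B i ω ^ 2) P t
      ≤ ∏ i, Real.exp (t * Var[B i; P] + 4 * (t * Var[B i; P]) ^ 2) := by
        rw [heq]
        exact Finset.prod_le_prod (fun i _ ↦ by positivity)
          fun i _ ↦ inv_sqrt_one_sub_le_exp (hx i)
    _ ≤ ∏ i : ι, Real.exp (t * Var[B i; P] + 4 * t ^ 2 * κ ^ 2) := by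
        refine Finset.prod_le_prod (fun i _ ↦ (Real.exp_pos _).le) fun i _ ↦ Real.exp_le_exp.mpr ?_
        rw [mul_pow, ← mul_assoc]
        gcongr
        · exact variance_nonneg _ _
        · exact hvar i
    _ = _ := by
        rw [← Real.exp_sum, Finset.sum_add_distrib, ← Finset.mul_sum]
        simp [mul_comm]

/-- A Hanson–Wright type inequality: `κ` bounds the absolute row sums of the covariance matrix of
the centered Gaussian vector `A`, hence its operator norm. -/
theorem sum_sq_deviation_le {ι : Type*} [Fintype ι] {A : ι → Ω → ℝ}
    (hA : HasGaussianLaw (fun ω ↦ (A · ω)) P) (h0 : ∀ i, P[A i] = 0) {κ : ℝ} (hκ : 0 < κ)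
    (hrow : ∀ i, ∑ j, |cov[A i, A j; P]| ≤ κ) {η : ℝ} (hη0 : 0 ≤ η) (hη : η ≤ 2) :
    P.real {ω | κ * Fintype.card ι * η ≤ |∑ i, A i ω ^ 2 - ∑ i, Var[A i; P]|} ≤
      2 * Real.exp (-(Fintype.card ι * η ^ 2 / 16)) := by
  have := hA.isProbabilityMeasure
  set n := (Fintype.card ι : ℝ)
  obtain ⟨B, hind, hBg, hB0, hBv, hBA⟩ := exists_independent_components hA h0 hrow
  have hvar : ∑ i, Var[A i; P] = ∑ i, Var[B i; P] := by
    have h : ∀ {C : ι → Ω → ℝ}, (∀ i, HasGaussianLaw (C i) P) → (∀ i, P[C i] = 0) →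
        ∑ i, Var[C i; P] = ∫ ω, ∑ i, C i ω ^ 2 ∂P := by
      intro C hC hC0
      rw [integral_finsetSum _ fun i _ ↦ (hC i).memLp_two.integrable_sq]
      exact Finset.sum_congr rfl fun i _ ↦
        variance_of_integral_eq_zero (hC i).aemeasurable (hC0 i)
    rw [h (fun i ↦ hA.eval i) h0, h hBg hB0]
    simp_rw [hBA]
  -- The exponent `η / (8 κ)` minimizes the Chernoff bound.
  set t := η / (8 * κ) with ht
  have htκ : t * κ = η / 8 := by rw [ht]; field_simp
  have ht0 : 0 ≤ t := by positivity
  have htabs : |t| * κ ≤ 1 / 4 := by rw [abs_of_nonneg ht0, htκ]; linarith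
  obtain ⟨hi1, hm1⟩ := mgf_sum_sq_le hind hBg hB0 hBv htabs
  obtain ⟨hi2, hm2⟩ := mgf_sum_sq_le hind hBg hB0 hBv (t := -t) (by rwa [abs_neg])
  set S := ∑ i, Var[B i; P]
  have h4 : 4 * t ^ 2 * κ ^ 2 = η ^ 2 / 16 := by
    rw [mul_assoc, ← mul_pow, htκ]; ring
  have htκ' : t * (κ * n * η) = n * η ^ 2 / 8 := by
    rw [← mul_assoc, ← mul_assoc, htκ]; ring
  have hup : P.real {ω | S + κ * n * η ≤ ∑ i, B i ω ^ 2} ≤ Real.exp (-(n * η ^ 2 / 16)) := by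
    refine (measure_ge_le_exp_mul_mgf _ ht0 hi1).trans ?_
    refine (mul_le_mul_of_nonneg_left hm1 (Real.exp_pos _).le).trans_eq ?_
    rw [← Real.exp_add, h4]
    congr 1
    linear_combination -htκ'
  have hlo : P.real {ω | ∑ i, B i ω ^ 2 ≤ S - κ * n * η} ≤ Real.exp (-(n * η ^ 2 / 16)) := by
    refine (measure_le_le_exp_mul_mgf _ (neg_nonpos.mpr ht0) hi2).trans ?_
    refine (mul_le_mul_of_nonneg_left hm2 (Real.exp_pos _).le).trans_eq ?_
    rw [← Real.exp_add, neg_sq, h4]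
    congr 1
    linear_combination -htκ'
  calc P.real {ω | κ * n * η ≤ |∑ i, A i ω ^ 2 - ∑ i, Var[A i; P]|}
      ≤ P.real ({ω | S + κ * n * η ≤ ∑ i, B i ω ^ 2} ∪ {ω | ∑ i, B i ω ^ 2 ≤ S - κ * n * η}) := by
        refine measureReal_mono fun ω hω ↦ ?_
        simp only [Set.mem_ofPred_eq, hvar, ← hBA, Set.mem_union] at hω ⊢
        rcases le_abs.mp hω with h | h
        · left; linarith
        · right; linarith
    _ ≤ _ := (measureReal_union_le _ _).trans (by linarith)

/-! ### Squared sums along a mixing Gaussian process -/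

section Mixing

variable {E : Type*} [MeasurableSpace E] {Z : ℕ → Ω → E}

lemma alphaCoeff_nonneg (l : ℕ) : 0 ≤ alphaCoeff P Z l :=
  Real.iSup_nonneg fun _ ↦ alphaDep_nonneg _ _

lemma alphaSum_nonneg (T : ℕ) : 0 ≤ alphaSum P Z T :=
  Finset.sum_nonneg fun l _ ↦ alphaCoeff_nonneg l

lemma alphaDep_le_alphaCoeff [IsProbabilityMeasure P] (t l : ℕ) :
    alphaDep P (sigmaOf Z (Set.Iic t)) (sigmaOf Z (Set.Ici (t + l))) ≤ alphaCoeff P Z l :=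
  le_ciSup (f := fun t ↦ alphaDep P (sigmaOf Z (Set.Iic t)) (sigmaOf Z (Set.Ici (t + l))))
    ⟨1, by rintro _ ⟨t, rfl⟩; exact alphaDep_le_one _ _⟩ t

/-- Both halves of a row of the covariance matrix run through distinct lags at most `T`. -/
lemma sum_range_dist_le (T s : ℕ) (hs : s < T) :
    ∑ t ∈ Finset.range T, alphaCoeff P Z (Nat.dist s t) ≤ 2 * alphaSum P Z T := by
  have hpart : ∀ I ⊆ Finset.range T, Set.InjOn (Nat.dist s) I →
      ∑ t ∈ I, alphaCoeff P Z (Nat.dist s t) ≤ alphaSum P Z T := by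
    intro I hI hinj
    rw [← Finset.sum_image (f := alphaCoeff P Z) hinj]
    refine Finset.sum_le_sum_of_subset_of_nonneg ?_ fun l _ _ ↦ alphaCoeff_nonneg l
    intro l hl
    obtain ⟨t, ht, rfl⟩ := Finset.mem_image.mp hl
    have := Finset.mem_range.mp (hI ht)
    simp only [Finset.mem_range, Nat.dist]
    omega
  rw [← Finset.sum_filter_add_sum_filter_not (Finset.range T) (fun t ↦ t ≤ s), two_mul]
  refine add_le_add (hpart _ (Finset.filter_subset _ _) ?_) (hpart _ (Finset.filter_subset _ _) ?_)
  all_goals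
    intro a ha b hb hab
    simp only [Finset.coe_filter, Set.mem_ofPred_eq, Nat.dist] at ha hb hab
    omega

variable {A : ℕ → Ω → ℝ} {v : ℝ}

lemma quadrantSlope_mul_abs_cov_le_alphaCoeff (hA : IsGaussianProcess A P)
    (hmeas : ∀ t, Measurable[MeasurableSpace.comap (Z t) inferInstance] (A t))
    (h0 : ∀ t, P[A t] = 0) (hv : ∀ t, Var[A t; P] = v) (s t : ℕ) :
    quadrantSlope * |cov[A s, A t; P]| ≤ v * alphaCoeff P Z (Nat.dist s t) := by
  have := hA.isProbabilityMeasure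
  have hv0 : 0 ≤ v := hv 0 ▸ variance_nonneg _ _
  wlog hst : s ≤ t generalizing s t
  · rw [covariance_comm, Nat.dist_comm]
    exact this t s (by omega)
  have hsigma : ∀ {r : ℕ} {I : Set ℕ}, r ∈ I → Measurable[sigmaOf Z I] (A r) := fun hr ↦
    (hmeas _).mono (le_iSup₂_of_le _ hr le_rfl) le_rfl
  have h := quadrantSlope_mul_abs_cov_le (hA.hasGaussianLaw_prodMk (s := s) (t := t))
    (hsigma (I := Set.Iic s) (by simp)) (hsigma (I := Set.Ici (s + (t - s))) (by simp; omega))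
    (h0 s) (h0 t) (hv s) (hv t)
  rw [Nat.dist_eq_sub_of_le hst]
  exact h.trans (mul_le_mul_of_nonneg_left (alphaDep_le_alphaCoeff s (t - s)) hv0)

/-- Deviation inequality for the sum of squares of a real Gaussian process adapted to `Z`, with
constant variance `v`. The mixing coefficients bound the row sums of the covariance matrix. -/
theorem sum_range_sq_deviation_le (hA : IsGaussianProcess A P)
    (hmeas : ∀ t, Measurable[MeasurableSpace.comap (Z t) inferInstance] (A t))
    (h0 : ∀ t, P[A t] = 0) (hv : ∀ t, Var[A t; P] = v) {T : ℕ} {κ η : ℝ}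
    (hκ : 2 * v * alphaSum P Z T ≤ quadrantSlope * κ) (hκ0 : 0 ≤ κ) (hη0 : 0 ≤ η) (hη : η ≤ 2) :
    P.real {ω | κ * T * η < |∑ t ∈ Finset.range T, A t ω ^ 2 - T * v|} ≤
      2 * Real.exp (-(T * η ^ 2 / 16)) := by
  have := hA.isProbabilityMeasure
  have hv0 : 0 ≤ v := hv 0 ▸ variance_nonneg _ _
  rcases hv0.eq_or_lt with rfl | hvpos
  · -- A process of variance zero vanishes almost surely.
    have hzero : ∀ᵐ ω ∂P, ∀ t, A t ω = 0 := by
      refine ae_all_iff.mpr fun t ↦ ?_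
      have h := ae_eq_integral_of_variance_eq_zero (hA.hasGaussianLaw_eval t).memLp_two (hv t)
      filter_upwards [h] with ω hω
      rw [hω, h0 t]
    have hnull : P.real {ω | κ * T * η < |∑ t ∈ Finset.range T, A t ω ^ 2 - T * 0|} = 0 := by
      rw [measureReal_eq_zero_iff]
      refine measure_mono_null (t := {ω | ¬ ∀ t, A t ω = 0}) (fun ω hω h ↦ ?_) hzero
      simp only [Set.mem_ofPred_eq, h] at hω
      have : 0 ≤ κ * T * η := by positivity
      simp at hω
      linarith
    rw [hnull]
    positivity
  have hrow : ∀ s : Finset.range T, ∑ t : Finset.range T, |cov[A s, A t; P]| ≤ κ := by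
    intro s
    have hs := Finset.mem_range.mp s.2
    refine le_of_mul_le_mul_left ?_ quadrantSlope_pos
    rw [Finset.sum_coe_sort (Finset.range T) fun t ↦ |cov[A s, A t; P]|, Finset.mul_sum]
    calc ∑ t ∈ Finset.range T, quadrantSlope * |cov[A s, A t; P]|
        ≤ ∑ t ∈ Finset.range T, v * alphaCoeff P Z (Nat.dist s t) :=
          Finset.sum_le_sum fun t _ ↦
            quadrantSlope_mul_abs_cov_le_alphaCoeff hA hmeas h0 hv s t
      _ ≤ v * (2 * alphaSum P Z T) := by
          rw [← Finset.mul_sum]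
          exact mul_le_mul_of_nonneg_left (sum_range_dist_le T s hs) hv0
      _ ≤ quadrantSlope * κ := by linarith
  rcases T.eq_zero_or_pos with rfl | hT
  · simp
  have hκpos : 0 < κ := by
    have h := hrow ⟨0, Finset.mem_range.mpr hT⟩
    have h1 := Finset.single_le_sum (f := fun t : Finset.range T ↦ |cov[A 0, A t; P]|)
      (fun _ _ ↦ abs_nonneg _) (Finset.mem_univ ⟨0, Finset.mem_range.mpr hT⟩)
    have h2 : |cov[A 0, A 0; P]| = v := by
      rw [covariance_self (hA.hasGaussianLaw_eval 0).aemeasurable, hv, abs_of_nonneg hv0]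
    simp only [h2] at h1
    exact hvpos.trans_le (h1.trans h)
  have h := sum_sq_deviation_le (A := fun t : Finset.range T ↦ A t)
    (hA.hasGaussianLaw (Finset.range T)) (fun t ↦ h0 t) hκpos hrow hη0 hη
  simp only [Fintype.card_coe, Finset.card_range, hv, Finset.sum_const, Finset.card_univ,
    nsmul_eq_mul] at h
  refine le_trans (measureReal_mono fun ω hω ↦ ?_) h
  simp only [Set.mem_ofPred_eq] at hω ⊢
  rw [Finset.sum_coe_sort (Finset.range T) fun t ↦ A t ω ^ 2]
  exact hω.le

end Mixing

end Gaussian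

variable {Ω : Type u} [MeasurableSpace Ω] {P : Measure Ω}

/-! ### The normal equations and second moments -/

lemma IsStrictlyStationary.map_eq {E : Type*} [MeasurableSpace E] {Z : ℕ → Ω → E}
    (hZ : IsStrictlyStationary P Z) (hm : ∀ t, Measurable (Z t)) (t : ℕ) :
    P.map (Z t) = P.map (Z 0) := by
  have h := congrArg (Measure.map fun f : Fin (0 + 1) → E ↦ f 0) (hZ 0 t 0)
  rw [Measure.map_map (by fun_prop) (by fun_prop), Measure.map_map (by fun_prop) (by fun_prop)] at h
  simpa [Function.comp_def] using h.symm

/-- `E ⟨u, V⟩² = u' E[V V'] u ≤ ‖E[V V']‖ ‖u‖²`. -/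
lemma integral_inner_sq_le {n : ℕ} {V : Ω → EuclideanSpace ℝ (Fin n)} (hV : MemLp V 2 P)
    (u : EuclideanSpace ℝ (Fin n)) :
    ∫ ω, inner ℝ u (V ω) ^ 2 ∂P ≤ opNorm (secondMoment P V) * ‖u‖ ^ 2 := by
  have hVi : ∀ i, MemLp (fun ω ↦ V ω i) 2 P := fun i ↦
    (EuclideanSpace.proj (𝕜 := ℝ) i).comp_memLp' hV
  have hVV : ∀ i j, Integrable (fun ω ↦ u i * u j * (V ω i * V ω j)) P := fun i j ↦
    ((hVi i).integrable_mul (hVi j)).const_mul _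
  have h : ∫ ω, inner ℝ u (V ω) ^ 2 ∂P =
      inner ℝ u (Matrix.toEuclideanCLM (𝕜 := ℝ) (secondMoment P V) u) := by
    have hexp : ∀ ω, inner ℝ u (V ω) ^ 2 = ∑ i, ∑ j, u i * u j * (V ω i * V ω j) := by
      intro ω
      rw [PiLp.inner_apply, sq, Finset.sum_mul_sum]
      exact Finset.sum_congr rfl fun i _ ↦ Finset.sum_congr rfl fun j _ ↦ by simp; ring
    simp_rw [hexp]
    rw [integral_finsetSum _ fun i _ ↦ integrable_finsetSum _ fun j _ ↦ hVV i j,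
      PiLp.inner_apply]
    refine Finset.sum_congr rfl fun i _ ↦ ?_
    rw [integral_finsetSum _ fun j _ ↦ hVV i j]
    simp only [integral_const_mul, Matrix.ofLp_toEuclideanCLM, Matrix.mulVec, dotProduct,
      secondMoment, Matrix.of_apply, RCLike.inner_apply, conj_trivial, Finset.sum_mul]
    exact Finset.sum_congr rfl fun j _ ↦ by ring
  rw [h]
  calc inner ℝ u (Matrix.toEuclideanCLM (𝕜 := ℝ) (secondMoment P V) u)
      ≤ ‖u‖ * ‖Matrix.toEuclideanCLM (𝕜 := ℝ) (secondMoment P V) u‖ := real_inner_le_norm _ _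
    _ ≤ ‖u‖ * (opNorm (secondMoment P V) * ‖u‖) := by
        gcongr
        exact ContinuousLinearMap.le_opNorm _ _
    _ = _ := by ring

lemma toEuclideanLin_transpose_apply {p q : ℕ} (B : Matrix (Fin p) (Fin q) ℝ)
    (x : EuclideanSpace ℝ (Fin p)) (j : Fin q) :
    Matrix.toEuclideanLin B.transpose x j = inner ℝ (WithLp.toLp 2 fun k ↦ B k j) x := by
  simp [PiLp.inner_apply, Matrix.toLpLin_apply, Matrix.mulVec, dotProduct, mul_comm]

/-- The normal equations: the residuals of the best linear predictor are uncorrelated with the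
covariates. They follow by moving the minimizer in the direction of a matrix unit. -/
lemma IsBestLinearPredictor.integral_mul_eq_zero {p q : ℕ}
    {X : ℕ → Ω → EuclideanSpace ℝ (Fin p)} {Y : ℕ → Ω → EuclideanSpace ℝ (Fin q)}
    {Θ : Matrix (Fin p) (Fin q) ℝ} (hΘ : IsBestLinearPredictor P X Y Θ)
    (hX : MemLp (X 0) 2 P) (hY : MemLp (Y 0) 2 P) (i : Fin p) (j : Fin q) :
    ∫ ω, X 0 ω i * (Y 0 ω j - inner ℝ (WithLp.toLp 2 fun k ↦ Θ k j) (X 0 ω)) ∂P = 0 := by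
  set W : Ω → EuclideanSpace ℝ (Fin q) :=
    fun ω ↦ Y 0 ω - Matrix.toEuclideanLin Θ.transpose (X 0 ω) with hWdef
  have hW : MemLp W 2 P :=
    hY.sub ((Matrix.toEuclideanLin Θ.transpose).toContinuousLinearMap.comp_memLp' hX)
  have hXi : MemLp (fun ω ↦ X 0 ω i) 2 P := (EuclideanSpace.proj (𝕜 := ℝ) i).comp_memLp' hX
  have hWj : MemLp (fun ω ↦ W ω j) 2 P := (EuclideanSpace.proj (𝕜 := ℝ) j).comp_memLp' hW
  have hWint : Integrable (fun ω ↦ ‖W ω‖ ^ 2) P := hW.integrable_norm_pow two_ne_zero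
  have hXW : Integrable (fun ω ↦ X 0 ω i * W ω j) P := hXi.integrable_mul hWj
  have hentry : ∀ ω, X 0 ω i * (Y 0 ω j - inner ℝ (WithLp.toLp 2 fun k ↦ Θ k j) (X 0 ω)) =
      X 0 ω i * W ω j := by
    intro ω
    rw [hWdef, PiLp.sub_apply, toEuclideanLin_transpose_apply]
  simp_rw [hentry]
  set m := ∫ ω, X 0 ω i * W ω j ∂P
  set a := ∫ ω, X 0 ω i ^ 2 ∂P
  have ha : 0 ≤ a := integral_nonneg fun ω ↦ sq_nonneg _
  have hquad : ∀ s : ℝ, 0 ≤ s ^ 2 * a - 2 * s * m := by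
    intro s
    have hmin := hΘ (Θ + s • Matrix.single i j 1)
    have hexp : ∀ ω, ‖Y 0 ω - Matrix.toEuclideanLin (Θ + s • Matrix.single i j 1).transpose
        (X 0 ω)‖ ^ 2 = ‖W ω‖ ^ 2 + (s ^ 2 * X 0 ω i ^ 2 - 2 * s * (X 0 ω i * W ω j)) := by
      intro ω
      have hdir : Y 0 ω - Matrix.toEuclideanLin (Θ + s • Matrix.single i j 1).transpose (X 0 ω) =
          W ω - (s * X 0 ω i) • EuclideanSpace.single j (1 : ℝ) := by
        ext k
        simp only [hWdef, PiLp.sub_apply, PiLp.smul_apply, toEuclideanLin_transpose_apply,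
          PiLp.inner_apply, Matrix.add_apply, Matrix.smul_apply, Matrix.single_apply,
          PiLp.single_apply, RCLike.inner_apply, conj_trivial, smul_eq_mul, mul_add,
          Finset.sum_add_distrib]
        by_cases hk : k = j
        · subst hk
          simp [Finset.sum_ite_eq]
          ring
        · simp [hk, Ne.symm hk]
      rw [hdir, norm_sub_sq_real, norm_smul, inner_smul_right]
      simp [mul_pow, EuclideanSpace.inner_single_right]
      ring
    simp_rw [hexp] at hmin
    have h1 : Integrable (fun ω ↦ s ^ 2 * X 0 ω i ^ 2) P := hXi.integrable_sq.const_mul _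
    have h2 : Integrable (fun ω ↦ 2 * s * (X 0 ω i * W ω j)) P := hXW.const_mul _
    have h3 : Integrable (fun ω ↦ s ^ 2 * X 0 ω i ^ 2 - 2 * s * (X 0 ω i * W ω j)) P := h1.sub h2
    rw [integral_add hWint h3, integral_sub h1 h2, integral_const_mul, integral_const_mul] at hmin
    exact (le_add_iff_nonneg_right _).mp hmin
  by_contra hm
  have h := hquad (m / (a + 1))
  have h1 : (m / (a + 1)) ^ 2 * a - 2 * (m / (a + 1)) * m =
      -(m ^ 2 * (a + 2) / (a + 1) ^ 2) := by
    field_simp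
    ring
  rw [h1] at h
  have : 0 < m ^ 2 * (a + 2) / (a + 1) ^ 2 := by positivity
  linarith

/-! ### The deviation bound -/

section Model

variable {p q : ℕ} {X : ℕ → Ω → EuclideanSpace ℝ (Fin p)} {Y : ℕ → Ω → EuclideanSpace ℝ (Fin q)}
  {Θ : Matrix (Fin p) (Fin q) ℝ}

/-- The scalar combination `x_i + ε w_j` of a covariate and a residual, `w = y - Θ' x`, as a
linear functional of the observation `(x, y)`. -/
noncomputable def polarForm (Θ : Matrix (Fin p) (Fin q) ℝ) (i : Fin p) (j : Fin q) (ε : ℝ) :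
    EuclideanSpace ℝ (Fin p) × EuclideanSpace ℝ (Fin q) →L[ℝ] ℝ :=
  (EuclideanSpace.proj i).comp (ContinuousLinearMap.fst ℝ _ _) +
    ε • ((EuclideanSpace.proj j).comp (ContinuousLinearMap.snd ℝ _ _) -
      (innerSL ℝ (WithLp.toLp 2 fun k ↦ Θ k j)).comp (ContinuousLinearMap.fst ℝ _ _))

lemma polarForm_apply (i : Fin p) (j : Fin q) (ε : ℝ) (x : EuclideanSpace ℝ (Fin p))
    (y : EuclideanSpace ℝ (Fin q)) :
    polarForm Θ i j ε (x, y) =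
      x i + ε * (y j - inner ℝ (WithLp.toLp 2 fun k ↦ Θ k j) x) := by
  simp [polarForm]

/-- The scale of the deviation bound,
`‖Σ_X‖ (1 + max_j ‖Θ_{:j}‖²) + ‖Σ_Y‖`. -/
noncomputable def momentScale (P : Measure Ω) (X : ℕ → Ω → EuclideanSpace ℝ (Fin p))
    (Y : ℕ → Ω → EuclideanSpace ℝ (Fin q)) (Θ : Matrix (Fin p) (Fin q) ℝ) : ℝ :=
  opNorm (secondMoment P (X 0)) * (1 + maxColNormSq Θ) + opNorm (secondMoment P (Y 0))

lemma momentScale_nonneg : 0 ≤ momentScale P X Y Θ := by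
  have h1 : 0 ≤ maxColNormSq Θ := Real.iSup_nonneg fun j ↦ sq_nonneg _
  have h2 : ∀ {n : ℕ} (M : Matrix (Fin n) (Fin n) ℝ), 0 ≤ opNorm M := fun M ↦ norm_nonneg _
  have := h2 (secondMoment P (X 0))
  have := h2 (secondMoment P (Y 0))
  unfold momentScale
  positivity

lemma integral_polarForm_sq_le (hX : MemLp (X 0) 2 P) (hY : MemLp (Y 0) 2 P) (i : Fin p)
    (j : Fin q) {ε : ℝ} (hε : ε ^ 2 = 1) :
    ∫ ω, polarForm Θ i j ε (X 0 ω, Y 0 ω) ^ 2 ∂P ≤ 3 * momentScale P X Y Θ := by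
  set θ : EuclideanSpace ℝ (Fin p) := WithLp.toLp 2 fun k ↦ Θ k j
  have hx := integral_inner_sq_le hX (EuclideanSpace.single i 1)
  have hθ := integral_inner_sq_le hX θ
  have hy := integral_inner_sq_le hY (EuclideanSpace.single j 1)
  simp only [EuclideanSpace.inner_single_left, PiLp.norm_single, map_one, one_mul,
    norm_one, one_pow, mul_one] at hx hy
  have hX2 : Integrable (fun ω ↦ X 0 ω i ^ 2) P :=
    ((EuclideanSpace.proj (𝕜 := ℝ) i).comp_memLp' hX).integrable_sq
  have hY2 : Integrable (fun ω ↦ Y 0 ω j ^ 2) P :=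
    ((EuclideanSpace.proj (𝕜 := ℝ) j).comp_memLp' hY).integrable_sq
  have hθ2 : Integrable (fun ω ↦ inner ℝ θ (X 0 ω) ^ 2) P :=
    ((innerSL ℝ θ).comp_memLp' hX).integrable_sq
  have hXY2 : Integrable (fun ω ↦ X 0 ω i ^ 2 + Y 0 ω j ^ 2) P := hX2.add hY2
  have hsum : Integrable (fun ω ↦ X 0 ω i ^ 2 + Y 0 ω j ^ 2 + inner ℝ θ (X 0 ω) ^ 2) P :=
    hXY2.add hθ2
  have hcol : ‖θ‖ ^ 2 ≤ maxColNormSq Θ :=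
    le_ciSup (f := fun j ↦ ‖WithLp.toLp 2 (fun i ↦ Θ i j)‖ ^ 2) (Set.finite_range _).bddAbove j
  have hop : 0 ≤ opNorm (secondMoment P (X 0)) := norm_nonneg _
  calc ∫ ω, polarForm Θ i j ε (X 0 ω, Y 0 ω) ^ 2 ∂P
      ≤ ∫ ω, 3 * (X 0 ω i ^ 2 + Y 0 ω j ^ 2 + inner ℝ θ (X 0 ω) ^ 2) ∂P := by
        refine integral_mono_of_nonneg (.of_forall fun ω ↦ sq_nonneg _) (hsum.const_mul 3)
          (.of_forall fun ω ↦ ?_)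
        simp only [polarForm_apply]
        change (X 0 ω i + ε * (Y 0 ω j - inner ℝ θ (X 0 ω))) ^ 2 ≤ _
        generalize X 0 ω i = x
        generalize Y 0 ω j = y
        generalize inner ℝ θ (X 0 ω) = z
        -- Cauchy-Schwarz for the three terms `x`, `ε y`, `-ε z`.
        have h1 := sq_nonneg (x - ε * y)
        have h2 := sq_nonneg (x + ε * z)
        have h3 := sq_nonneg (y + z)
        linear_combination h1 + h2 + h3 + (2 * y ^ 2 + 2 * z ^ 2 - 2 * y * z) * hε
    _ = 3 * ((∫ ω, X 0 ω i ^ 2 ∂P) + (∫ ω, Y 0 ω j ^ 2 ∂P) + ∫ ω, inner ℝ θ (X 0 ω) ^ 2 ∂P) := by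
        rw [integral_const_mul, integral_add hXY2 hθ2, integral_add hX2 hY2]
    _ ≤ 3 * momentScale P X Y Θ := by
        have := mul_le_mul_of_nonneg_left hcol hop
        unfold momentScale
        linarith

/-- The deviation inequality for one of the two squares in the polarization of a cross term. -/
lemma IsGaussianMixingModel.polarForm_deviation_le (h : IsGaussianMixingModel P X Y)
    (i : Fin p) (j : Fin q) {ε : ℝ} (hε : ε ^ 2 = 1) {T : ℕ} {η : ℝ} (hη0 : 0 ≤ η) (hη : η ≤ 2) :
    P.real {ω | 6 * momentScale P X Y Θ * alphaSum P (pairProcess X Y) T / quadrantSlope * T * η <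
      |∑ t ∈ Finset.range T, polarForm Θ i j ε (X t ω, Y t ω) ^ 2 -
        T * ∫ ω, polarForm Θ i j ε (X 0 ω, Y 0 ω) ^ 2 ∂P|} ≤
      2 * Real.exp (-(T * η ^ 2 / 16)) := by
  set Z := pairProcess X Y with hZ
  set L := polarForm Θ i j ε
  have hZm : ∀ t, Measurable (Z t) := fun t ↦ (h.measurable_X t).prodMk (h.measurable_Y t)
  have hA : IsGaussianProcess (fun t ω ↦ L (Z t ω)) P := h.gaussian.comp_left fun _ ↦ L
  have hZint : ∀ t, Integrable (Z t) P := fun t ↦ (h.gaussian.hasGaussianLaw_eval t).integrable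
  have h0 : ∀ t, ∫ ω, L (Z t ω) ∂P = 0 := by
    intro t
    have hzero : ∫ ω, Z t ω ∂P = 0 := by
      have h1 := integral_pair (f := X t) (g := Y t) (hZint t).fst (hZint t).snd
      rw [h.centered_X, h.centered_Y] at h1
      exact h1
    rw [L.integral_comp_comm (hZint t), hzero, map_zero]
  have hv : ∀ t, Var[fun ω ↦ L (Z t ω); P] = ∫ ω, L (X 0 ω, Y 0 ω) ^ 2 ∂P := by
    intro t
    rw [variance_of_integral_eq_zero (hA.aemeasurable t) (h0 t)]
    have hmap : ∀ t, ∫ ω, L (Z t ω) ^ 2 ∂P = ∫ z, L z ^ 2 ∂P.map (Z t) := fun t ↦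
      (integral_map (f := fun z ↦ L z ^ 2) (hZm t).aemeasurable
        (L.continuous.pow 2).aestronglyMeasurable).symm
    rw [hmap t, hZ, h.stationary.map_eq hZm t]
    exact (hmap 0).symm
  have hZ2 : MemLp (Z 0) 2 P := (h.gaussian.hasGaussianLaw_eval 0).memLp_two
  have hle := integral_polarForm_sq_le (Θ := Θ) hZ2.fst hZ2.snd i j hε
  have hS : 0 ≤ alphaSum P Z T := alphaSum_nonneg T
  have hM : 0 ≤ momentScale P X Y Θ := momentScale_nonneg
  refine sum_range_sq_deviation_le hA (Z := Z) (fun t ↦ ?_) h0 hv ?_ ?_ hη0 hη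
  · exact L.continuous.measurable.comp (comap_measurable (Z t))
  · rw [mul_div_cancel₀ _ quadrantSlope_pos.ne']
    have := mul_le_mul_of_nonneg_right hle hS
    linarith
  · have := quadrantSlope_pos
    positivity

/-- The deviation inequality for one entry of `X'W`. By polarization, `4 X_i W_j` is the difference
of the squares of `X_i + W_j` and `X_i - W_j`, and by the normal equations these have equal
expectations. -/
lemma IsGaussianMixingModel.entry_deviation_le (h : IsGaussianMixingModel P X Y)
    (hΘ : IsBestLinearPredictor P X Y Θ) (i : Fin p) (j : Fin q) {T : ℕ} {η : ℝ} (hη0 : 0 ≤ η)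
    (hη : η ≤ 2) :
    P.real {ω | 3 * momentScale P X Y Θ * alphaSum P (pairProcess X Y) T / quadrantSlope * T * η <
      |((dataMatrix X T ω).transpose * residualMatrix X Y Θ T ω) i j|} ≤
      4 * Real.exp (-(T * η ^ 2 / 16)) := by
  have := h.gaussian.isProbabilityMeasure
  set κ := 3 * momentScale P X Y Θ * alphaSum P (pairProcess X Y) T / quadrantSlope with hκ
  have hZ2 : MemLp (pairProcess X Y 0) 2 P := (h.gaussian.hasGaussianLaw_eval 0).memLp_two
  have hsq : ∀ ε, Integrable (fun ω ↦ polarForm Θ i j ε (X 0 ω, Y 0 ω) ^ 2) P := fun ε ↦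
    ((polarForm Θ i j ε).comp_memLp' hZ2).integrable_sq
  have hpolar : ∀ t ω, polarForm Θ i j 1 (X t ω, Y t ω) ^ 2 -
      polarForm Θ i j (-1) (X t ω, Y t ω) ^ 2 =
      4 * (X t ω i * (Y t ω j - inner ℝ (WithLp.toLp 2 fun k ↦ Θ k j) (X t ω))) := by
    intro t ω
    simp only [polarForm_apply]
    ring
  have hmean : ∫ ω, polarForm Θ i j 1 (X 0 ω, Y 0 ω) ^ 2 ∂P =
      ∫ ω, polarForm Θ i j (-1) (X 0 ω, Y 0 ω) ^ 2 ∂P := by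
    rw [← sub_eq_zero, ← integral_sub (hsq 1) (hsq (-1))]
    simp_rw [hpolar]
    rw [integral_const_mul, hΘ.integral_mul_eq_zero hZ2.fst hZ2.snd, mul_zero]
  have hentry : ∀ ω, 4 * ((dataMatrix X T ω).transpose * residualMatrix X Y Θ T ω) i j =
      ∑ t ∈ Finset.range T, polarForm Θ i j 1 (X t ω, Y t ω) ^ 2 -
        ∑ t ∈ Finset.range T, polarForm Θ i j (-1) (X t ω, Y t ω) ^ 2 := by
    intro ω
    rw [← Finset.sum_sub_distrib]
    simp only [hpolar]
    rw [← Finset.mul_sum, Finset.sum_range, Matrix.mul_apply]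
    simp [dataMatrix, residualMatrix, Matrix.mul_apply, PiLp.inner_apply, mul_comm]
  have h1 := h.polarForm_deviation_le (Θ := Θ) i j (ε := 1) (one_pow 2) (T := T) hη0 hη
  have h2 := h.polarForm_deviation_le (Θ := Θ) i j (ε := -1) (by norm_num) (T := T) hη0 hη
  have h6 : 6 * momentScale P X Y Θ * alphaSum P (pairProcess X Y) T / quadrantSlope = 2 * κ := by
    rw [hκ]; ring
  rw [h6] at h1 h2
  rw [← hmean] at h2
  set m := ∫ ω, polarForm Θ i j 1 (X 0 ω, Y 0 ω) ^ 2 ∂P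
  refine (measureReal_mono (fun ω hω ↦ ?_)).trans ((measureReal_union_le
    {ω | 2 * κ * T * η < |∑ t ∈ Finset.range T, polarForm Θ i j 1 (X t ω, Y t ω) ^ 2 - T * m|}
    {ω | 2 * κ * T * η <
      |∑ t ∈ Finset.range T, polarForm Θ i j (-1) (X t ω, Y t ω) ^ 2 - T * m|}).trans
    (by linarith))
  simp only [Set.mem_union, Set.mem_ofPred_eq] at hω ⊢
  by_contra! hcon
  have h4 : 4 * |((dataMatrix X T ω).transpose * residualMatrix X Y Θ T ω) i j| ≤
      2 * κ * T * η + 2 * κ * T * η := by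
    rw [← abs_of_pos (four_pos (α := ℝ)), ← abs_mul, hentry,
      ← sub_sub_sub_cancel_right _ _ (T * m)]
    exact (abs_sub _ _).trans (add_le_add hcon.1 hcon.2)
  linarith

end Model

/-- The deviation bound holds as soon as `T ≥ 4 (b + 1) log(pq)` and `c` is at most the square of
the slope of the quadrant probability. -/
theorem gaussianDeviationBound_of_le {b c : ℝ} {p q T : ℕ} (hb : 0 < b) (hc : 0 < c)
    (hcslope : c ≤ quadrantSlope ^ 2) (hp : 0 < p) (hq : 0 < q) (hT : 0 < T)
    (hlog : 4 * (b + 1) * Real.log ((p : ℝ) * q) ≤ T) :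
    GaussianDeviationBound.{u} b c p q T := by
  intro Ω _ P _ X Y Θ h hΘ
  have : Nonempty (Fin p × Fin q) := ⟨⟨0, hp⟩, ⟨0, hq⟩⟩
  have hpq : (1 : ℝ) ≤ (p : ℝ) * q := by exact_mod_cast Nat.mul_pos hp hq
  have hT' : (0 : ℝ) < T := by exact_mod_cast hT
  set ℓ := Real.log ((p : ℝ) * q)
  have hℓ : 0 ≤ ℓ := Real.log_nonneg hpq
  have hslope := quadrantSlope_pos
  -- With this `η` the exponent of the entrywise bound is `(b + 1) log(pq)`.
  set η := 4 * (√(b + 1) * √(ℓ / T)) with hη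
  have hη0 : 0 ≤ η := by positivity
  have hηsq : T * η ^ 2 / 16 = (b + 1) * ℓ := by
    rw [hη, mul_pow, mul_pow, Real.sq_sqrt (by positivity), Real.sq_sqrt (by positivity)]
    field_simp
    ring
  have hη2 : η ≤ 2 := by
    have h1 : T * η ^ 2 ≤ T * 2 ^ 2 := by linarith
    exact (pow_le_pow_iff_left₀ hη0 zero_le_two two_ne_zero).mp (le_of_mul_le_mul_left h1 hT')
  set S := alphaSum P (pairProcess X Y) T
  have hS : 0 ≤ S := alphaSum_nonneg T
  set M := momentScale P X Y Θ
  have hM : 0 ≤ M := momentScale_nonneg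
  set τ := multiplier P X Y Θ b c * rate P X Y T
  have hτ : 3 * M * S / quadrantSlope * T * η ≤ T * τ := by
    have hcs : √c ≤ quadrantSlope := Real.sqrt_le_iff.mpr ⟨hslope.le, hcslope⟩
    have hcpos : 0 < √c := Real.sqrt_pos.mpr hc
    have hτeq : τ = M * S * √(b + 1) * √(ℓ / T) * (8 * Real.pi / √c) := by
      change 8 * Real.pi * √((b + 1) / c) * M * (S * √(ℓ / T)) = _
      rw [Real.sqrt_div (by positivity)]
      ring
    have hconst : 12 / quadrantSlope ≤ 8 * Real.pi / √c := by
      have := Real.pi_gt_three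
      gcongr
      linarith
    calc 3 * M * S / quadrantSlope * T * η
        = T * (M * S * √(b + 1) * √(ℓ / T) * (12 / quadrantSlope)) := by rw [hη]; ring
      _ ≤ T * τ := by
          rw [hτeq]
          gcongr
  set D : Ω → Matrix (Fin p) (Fin q) ℝ := fun ω ↦
    (dataMatrix X T ω).transpose * residualMatrix X Y Θ T ω
  set good : Set Ω := {ω | maxNorm ((1 / (T : ℝ)) • D ω) ≤ τ} with hgood
  have hcompl : goodᶜ ⊆ ⋃ ij : Fin p × Fin q, {ω | T * τ < |D ω ij.1 ij.2|} := by
    intro ω hω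
    by_contra hcon
    simp only [Set.mem_iUnion, Set.mem_ofPred_eq, not_exists, not_lt] at hcon
    refine hω (show maxNorm _ ≤ τ from ciSup_le fun ij ↦ ?_)
    rw [Matrix.smul_apply, smul_eq_mul, abs_mul, abs_of_nonneg (by positivity), one_div,
      inv_mul_le_iff₀ hT']
    exact hcon ij
  have hentry : ∀ ij : Fin p × Fin q, P.real {ω | T * τ < |D ω ij.1 ij.2|} ≤
      4 * Real.exp (-((b + 1) * ℓ)) := by
    intro ij
    rw [← hηsq]
    exact (measureReal_mono fun ω hω ↦ hτ.trans_lt hω).trans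
      (h.entry_deviation_le hΘ ij.1 ij.2 hη0 hη2)
  have hbad : P.real goodᶜ ≤ 4 * Real.exp (-b * ℓ) := by
    calc P.real goodᶜ ≤ ∑ ij : Fin p × Fin q, P.real {ω | T * τ < |D ω ij.1 ij.2|} :=
          (measureReal_mono hcompl).trans (measureReal_iUnion_fintype_le _)
      _ ≤ ∑ _ij : Fin p × Fin q, 4 * Real.exp (-((b + 1) * ℓ)) :=
          Finset.sum_le_sum fun ij _ ↦ hentry ij
      _ = 4 * (Real.exp ℓ * Real.exp (-((b + 1) * ℓ))) := by
          rw [Real.exp_log (by linarith)]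
          simp
          ring
      _ = 4 * Real.exp (-b * ℓ) := by
          rw [← Real.exp_add]
          ring_nf
  have htotal : 1 ≤ P.real good + P.real goodᶜ := by
    have := measureReal_union_le (μ := P) good goodᶜ
    rwa [Set.union_compl_self, probReal_univ] at this
  have := Real.exp_pos (-b * ℓ)
  linarith

end LassoMixing

theorem mainTheorem5 :
    (∃ c : ℝ, 0 < c ∧ ∀ b : ℝ, 0 < b →
      ∀ p q T : ℕ, 0 < p → 0 < q → 0 < T →
        (b + 1) / c * Real.log ((p : ℝ) * q) ≤ (T : ℝ) →
          LassoMixing.GaussianDeviationBound.{u} b c p q T) ∧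
    (∀ B : ℝ, 0 < B → ∃ c : ℝ, 0 < c ∧ ∀ b : ℝ, 0 < b → b ≤ B →
      ∀ p q T : ℕ, 0 < p → 0 < q → 0 < T →
        Real.sqrt ((b + 1) / c) * Real.log ((p : ℝ) * q) ≤ (T : ℝ) →
          LassoMixing.GaussianDeviationBound.{u} b c p q T) := by
  have hslope : 0 < LassoMixing.quadrantSlope ^ 2 := pow_pos LassoMixing.quadrantSlope_pos 2
  have hlog : ∀ {p q : ℕ}, 0 < p → 0 < q → 0 ≤ Real.log ((p : ℝ) * q) := fun hp hq ↦
    Real.log_nonneg (by exact_mod_cast Nat.mul_pos hp hq)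
  constructor
  · refine ⟨min (1 / 4) (LassoMixing.quadrantSlope ^ 2), by positivity,
      fun b hb p q T hp hq hT h ↦ ?_⟩
    set c := min (1 / 4) (LassoMixing.quadrantSlope ^ 2)
    have hc : 0 < c := by positivity
    refine LassoMixing.gaussianDeviationBound_of_le hb hc (min_le_right _ _) hp hq hT
      (le_trans (mul_le_mul_of_nonneg_right ?_ (hlog hp hq)) h)
    rw [le_div_iff₀ hc]
    nlinarith [min_le_left (1 / 4) (LassoMixing.quadrantSlope ^ 2)]
  · intro B hB
    -- For `b ≤ B` this choice gives `4 (b + 1) ≤ √((b + 1) / c)`.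
    refine ⟨min (1 / (16 * (B + 1))) (LassoMixing.quadrantSlope ^ 2), by positivity,
      fun b hb hbB p q T hp hq hT h ↦ ?_⟩
    set c := min (1 / (16 * (B + 1))) (LassoMixing.quadrantSlope ^ 2)
    have hc : 0 < c := by positivity
    refine LassoMixing.gaussianDeviationBound_of_le hb hc (min_le_right _ _) hp hq hT
      (le_trans (mul_le_mul_of_nonneg_right (Real.le_sqrt_of_sq_le ?_) (hlog hp hq)) h)
    have hcB : c * (16 * (B + 1)) ≤ 1 :=
      (le_div_iff₀ (by positivity)).mp (min_le_left _ _)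
    rw [le_div_iff₀ hc]
    have hcb : c * (16 * (b + 1)) ≤ 1 := le_trans (by gcongr) hcB
    nlinarith [mul_le_mul_of_nonneg_left hcb (by linarith : 0 ≤ b + 1)]
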